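/- Let $\mathcal H^A,\mathcal H^B,\mathcal H^{A'},\mathcal H^{B'}$ be finite-dimensional complex Hilbert spaces. For a normalised pure state $\zeta$ of a bipartite system, let $\sigma(\zeta)$ be its Schmidt coefficients, i.e. the eigenvalues of its reduced density matrix (so they sum to $1$). For a state of dimension $n\ge k\ge 1$, its $k$-th generalised concurrence is $$C_k(\zeta)=\left(\frac{e_k(\sigma(\zeta))}{e_k(1/n,\dots,1/n)}\right)^{1/k},$$ where $e_k$ is the $k$-th elementary symmetric polynomial and $(1/n,\dots,1/n)\in\mathbb R^n$. Let $\psi,\phi\in\mathcal H^A\otimes\mathcal H^B$ and $\chi\in\mathcal H^{A'}\otimes\mathcal H^{B'}$ be normalised pure states such that $\psi\otimes\chi$ can be transformed into $\phi\otimes\chi$ by local operations of the two parties $AA'$ and $BB'$ and classical communication (LOCC, in finitely many rounds), with certainty. Suppose that $\psi$ and $\phi$ each have precisely $d$ nonzero Schmidt coefficients, that $\chi$ has precisely $b$ nonzero Schmidt coefficients, and that $C_d(\psi)\ne C_d(\phi)$. Then, with the concurrences of $\psi$ and $\phi$ taken in dimension $n=d$, $$b\;\ge\;1+\left(\frac{d-1}{d}\right)\frac{\log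 C_{d-1}(\phi)-\log C_{d-1}(\psi)}{\log C_d(\psi)-\log C_d(\phi)} .$$ -/

import Mathlib

open scoped Kronecker Matrix

noncomputable section

/-- A normalised pure state of a bipartite system `ℂ^A ⊗ ℂ^B`, given by its amplitudes
`ζ = ∑ a b, amp a b • |a⟩ ⊗ |b⟩` in a product orthonormal basis. -/
structure PureState (A B : Type) [Fintype A] [Fintype B] where
  amp : Matrix A B ℂ
  normalized : ∑ a, ∑ b, ‖amp a b‖ ^ 2 = 1

namespace PureState

variable {A B A' B' : Type} [Fintype A] [Fintype B] [Fintype A'] [Fintype B']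

/-- The density matrix `|ζ⟩⟨ζ|` on the joint system. -/
def density (ζ : PureState A B) : Matrix (A × B) (A × B) ℂ :=
  Matrix.of fun p q => ζ.amp p.1 p.2 * star (ζ.amp q.1 q.2)

/-- The state `ψ ⊗ χ`, shared so that one party holds `A` and `A'`, the other `B` and `B'`. -/
def tensor (ψ : PureState A B) (χ : PureState A' B') : PureState (A × A') (B × B') where
  amp := ψ.amp ⊗ₖ χ.amp
  normalized := by
    have h : ∑ x : A × A', ∑ y : B × B', ‖(ψ.amp ⊗ₖ χ.amp) x y‖ ^ 2
        = (∑ a, ∑ b, ‖ψ.amp a b‖ ^ 2) * (∑ a, ∑ b, ‖χ.amp a b‖ ^ 2) := by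
      simp only [Matrix.kroneckerMap_apply, norm_mul, mul_pow]
      rw [Fintype.sum_prod_type, Finset.sum_mul_sum]
      refine Finset.sum_congr rfl fun a _ => Finset.sum_congr rfl fun a' _ => ?_
      rw [Fintype.sum_prod_type, Finset.sum_mul_sum]
    rw [h, ψ.normalized, χ.normalized, one_mul]

/-- The reduced density matrix of the first party, `tr_B |ζ⟩⟨ζ|`. -/
def reduced (ζ : PureState A B) : Matrix A A ℂ :=
  Matrix.of fun a a' => ∑ b, ζ.density (a, b) (a', b)

lemma reduced_eq (ζ : PureState A B) : ζ.reduced = ζ.amp * ζ.ampᴴ := by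
  ext a a'
  simp [reduced, density, Matrix.mul_apply]

lemma reduced_isHermitian (ζ : PureState A B) : ζ.reduced.IsHermitian := by
  rw [reduced_eq]
  exact Matrix.isHermitian_mul_conjTranspose_self ζ.amp

variable [DecidableEq A]

/-- The Schmidt coefficients, normalised to sum `1`: the eigenvalues, with multiplicity, of the
reduced density matrix (the squares of the coefficients in a Schmidt decomposition). There may be
additional zeros, which change no elementary symmetric polynomial. -/
def schmidtCoeffs (ζ : PureState A B) : Multiset ℝ :=
  Finset.univ.val.map ζ.reduced_isHermitian.eigenvalues

/-- The number of nonzero Schmidt coefficients. -/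
def schmidtRank (ζ : PureState A B) : ℕ :=
  (ζ.schmidtCoeffs.filter fun x => x ≠ 0).card

/-- The `k`-th generalised concurrence of `ζ` as a state of dimension `n`:
`(e_k(σ(ζ)) / e_k(1/n, …, 1/n)) ^ (1/k)`. -/
def concurrence (n k : ℕ) (ζ : PureState A B) : ℝ :=
  (ζ.schmidtCoeffs.esymm k / (Multiset.replicate n (1 / (n : ℝ))).esymm k) ^ (1 / (k : ℝ))

end PureState

/-- `IsLOCC A₂ B₂ A B Λ`: the map `Λ`, from density matrices on `A × B` to density matrices on
`A₂ × B₂`, is realised by a protocol of finitely many rounds of local operations and classical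
communication. In each round one party performs a general measurement with Kraus operators `K i`,
`∑ i, (K i)ᴴ * K i = 1` (possibly into another space, so that adding and discarding local systems
and local unitaries are included), and announces the outcome `i`, on which the rest `Λ i` of the
protocol may depend. At the end the outcomes are forgotten. -/
inductive IsLOCC (A₂ B₂ : Type) [Fintype A₂] [DecidableEq A₂] [Fintype B₂] [DecidableEq B₂] :
    (A B : Type) → [Fintype A] → [DecidableEq A] → [Fintype B] → [DecidableEq B] →
    (Matrix (A × B) (A × B) ℂ → Matrix (A₂ × B₂) (A₂ × B₂) ℂ) → Prop
  | done : IsLOCC A₂ B₂ A₂ B₂ fun ρ => ρ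
  | alice {A B I : Type} [Fintype A] [DecidableEq A] [Fintype B] [DecidableEq B] [Fintype I]
      {A' : I → Type} [∀ i, Fintype (A' i)] [∀ i, DecidableEq (A' i)]
      (K : ∀ i, Matrix (A' i) A ℂ) (hK : ∑ i, (K i)ᴴ * K i = 1)
      (Λ : ∀ i, Matrix (A' i × B) (A' i × B) ℂ → Matrix (A₂ × B₂) (A₂ × B₂) ℂ)
      (hΛ : ∀ i, IsLOCC A₂ B₂ (A' i) B (Λ i)) :
      IsLOCC A₂ B₂ A B fun ρ =>
        ∑ i, Λ i ((K i ⊗ₖ (1 : Matrix B B ℂ)) * ρ * (K i ⊗ₖ (1 : Matrix B B ℂ))ᴴ)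
  | bob {A B I : Type} [Fintype A] [DecidableEq A] [Fintype B] [DecidableEq B] [Fintype I]
      {B' : I → Type} [∀ i, Fintype (B' i)] [∀ i, DecidableEq (B' i)]
      (K : ∀ i, Matrix (B' i) B ℂ) (hK : ∑ i, (K i)ᴴ * K i = 1)
      (Λ : ∀ i, Matrix (A × B' i) (A × B' i) ℂ → Matrix (A₂ × B₂) (A₂ × B₂) ℂ)
      (hΛ : ∀ i, IsLOCC A₂ B₂ A (B' i) (Λ i)) :
      IsLOCC A₂ B₂ A B fun ρ =>
        ∑ i, Λ i (((1 : Matrix A A ℂ) ⊗ₖ K i) * ρ * ((1 : Matrix A A ℂ) ⊗ₖ K i)ᴴ)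

/-- `ψ ↦ φ` by LOCC: some LOCC operation maps `|ψ⟩⟨ψ|` to `|φ⟩⟨φ|` (with certainty). -/
def LOCCConvertible {A B A₂ B₂ : Type} [Fintype A] [DecidableEq A] [Fintype B] [DecidableEq B]
    [Fintype A₂] [DecidableEq A₂] [Fintype B₂] [DecidableEq B₂]
    (ψ : PureState A B) (φ : PureState A₂ B₂) : Prop :=
  ∃ Λ : Matrix (A × B) (A × B) ℂ → Matrix (A₂ × B₂) (A₂ × B₂) ℂ,
    IsLOCC A₂ B₂ A B Λ ∧ Λ ψ.density = φ.density

end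

/-!
For `k ≥ 1` the function `e_k ^ (1/k)` is superadditive on nonnegative vectors (Marcus–Lopes): it
is a geometric mean of the ratios `e_(j+1) / e_j`, which are superadditive by induction on `j`.
Being symmetric and homogeneous as well, it is Schur concave, and therefore superadditive on
positive semidefinite matrices as a function of the spectrum. A local measurement writes the
reduced state of the passive party as the sum of its unnormalised reduced states after each
outcome, so `e_k ^ (1/k)` of the Schmidt coefficients never increases on average under LOCC; a pure
final state forces every branch of the protocol to end in a multiple of it, so `e_k` itself does
not increase.

The nonzero Schmidt coefficients of `ψ ⊗ χ` are the products of those of `ψ` and `χ`, so `e_(db)`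
and `e_(db-1)` of them factor: their parts from `ψ` are `e_d(ψ)^b` and
`e_d(ψ)^(b-1) * e_(d-1)(ψ)`, and the parts from `χ` cancel. Monotonicity at `k = db` gives
`e_d(φ) ≤ e_d(ψ)`, and at `k = db - 1`, after taking logarithms, the bound on `b`.
-/

section MultisetEsymm

variable {R : Type*}

section CommSemiring

variable [CommSemiring R]

theorem esymm_zero (s : Multiset R) : s.esymm 0 = 1 := by
  simp [Multiset.esymm]

theorem esymm_cons_succ (a : R) (s : Multiset R) (k : ℕ) :
    (a ::ₘ s).esymm (k + 1) = s.esymm (k + 1) + a * s.esymm k := by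
  simp [Multiset.esymm, Multiset.powersetCard_cons, Multiset.sum_map_mul_left]

theorem esymm_zero_cons (s : Multiset R) (k : ℕ) : (0 ::ₘ s).esymm k = s.esymm k := by
  cases k with
  | zero => rw [esymm_zero, esymm_zero]
  | succ k => rw [esymm_cons_succ, zero_mul, add_zero]

theorem esymm_filter_ne_zero [DecidableEq R] (s : Multiset R) (k : ℕ) :
    (s.filter (· ≠ 0)).esymm k = s.esymm k := by
  induction s using Multiset.induction_on generalizing k with
  | empty => rfl
  | cons a s ih =>
    rcases eq_or_ne a 0 with rfl | ha
    · rw [Multiset.filter_cons_of_neg _ (by simp), esymm_zero_cons, ih]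
    · rw [Multiset.filter_cons_of_pos (p := (· ≠ 0)) _ ha]
      cases k with
      | zero => rw [esymm_zero, esymm_zero]
      | succ k => rw [esymm_cons_succ, esymm_cons_succ, ih, ih]

theorem esymm_eq_zero_of_card_lt {s : Multiset R} {k : ℕ} (hk : s.card < k) : s.esymm k = 0 := by
  rw [Multiset.esymm, Multiset.powersetCard_eq_empty _ hk, Multiset.map_zero, Multiset.sum_zero]

theorem esymm_card (s : Multiset R) : s.esymm s.card = s.prod := by
  induction s using Multiset.induction_on with
  | empty => simp [esymm_zero]
  | cons a s ih =>
    rw [Multiset.card_cons, esymm_cons_succ, esymm_eq_zero_of_card_lt s.card.lt_succ_self, ih,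
      zero_add, Multiset.prod_cons]

end CommSemiring

theorem esymm_card_sub_one [Field R] {s : Multiset R} (hs : ∀ x ∈ s, x ≠ 0) (hcard : s.card ≠ 0) :
    s.esymm (s.card - 1) = s.prod * (s.map (·⁻¹)).sum := by
  induction s using Multiset.induction_on with
  | empty => exact absurd Multiset.card_zero hcard
  | cons a s ih =>
    have ha : a ≠ 0 := hs a (Multiset.mem_cons_self a s)
    have hs' : ∀ x ∈ s, x ≠ 0 := fun x hx => hs x (Multiset.mem_cons_of_mem hx)
    rw [Multiset.card_cons, Nat.add_sub_cancel, Multiset.prod_cons, Multiset.map_cons,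
      Multiset.sum_cons]
    rcases Nat.eq_zero_or_eq_succ_pred s.card with h0 | hsucc
    · obtain rfl := Multiset.card_eq_zero.1 h0
      simp [esymm_zero, ha]
    · have hpred : s.esymm s.card.pred = s.prod * (s.map (·⁻¹)).sum := ih hs' (by omega)
      have htop : s.esymm (s.card.pred + 1) = s.prod := hsucc ▸ esymm_card s
      rw [hsucc, esymm_cons_succ, htop, hpred]
      field_simp

section Ordered

variable [CommSemiring R] [PartialOrder R]

theorem esymm_nonneg [IsOrderedRing R] {s : Multiset R} (hs : ∀ x ∈ s, 0 ≤ x) (k : ℕ) :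
    0 ≤ s.esymm k := by
  refine Multiset.sum_nonneg fun y hy => ?_
  obtain ⟨t, ht, rfl⟩ := Multiset.mem_map.1 hy
  exact Multiset.prod_nonneg fun a ha =>
    hs a (Multiset.mem_of_le (Multiset.mem_powersetCard.1 ht).1 ha)

theorem esymm_pos [IsStrictOrderedRing R] {s : Multiset R} (hs : ∀ x ∈ s, 0 < x) {k : ℕ}
    (hk : k ≤ s.card) : 0 < s.esymm k := by
  induction s using Multiset.induction_on generalizing k with
  | empty =>
    obtain rfl := Nat.le_zero.1 hk
    simp [esymm_zero]
  | cons a s ih =>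
    have ha : 0 < a := hs a (Multiset.mem_cons_self a s)
    have hs' : ∀ x ∈ s, 0 < x := fun x hx => hs x (Multiset.mem_cons_of_mem hx)
    cases k with
    | zero => simp [esymm_zero]
    | succ k =>
      rw [Multiset.card_cons, Nat.succ_le_succ_iff] at hk
      rw [esymm_cons_succ]
      exact add_pos_of_nonneg_of_pos (esymm_nonneg (fun x hx => (hs' x hx).le) _)
        (mul_pos ha (ih hs' hk))

theorem esymm_succ_eq_zero [IsStrictOrderedRing R] {s : Multiset R}
    (hs : ∀ x ∈ s, 0 ≤ x) {k : ℕ} (h : s.esymm k = 0) : s.esymm (k + 1) = 0 := by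
  classical
  rw [← esymm_filter_ne_zero] at h ⊢
  refine esymm_eq_zero_of_card_lt (Nat.lt_succ_of_lt ?_)
  by_contra! hk
  refine (esymm_pos (fun x hx => ?_) hk).ne' h
  rw [Multiset.mem_filter] at hx
  exact (hs x hx.1).lt_of_ne' hx.2

end Ordered

end MultisetEsymm

section EsymmOn

variable {ι R K : Type*}

/-- The elementary symmetric polynomial of degree `k` in the variables indexed by the finite set
`s`, evaluated at `x`. Keeping `s` explicit lets single variables be removed. -/
def esymmOn [CommSemiring R] (s : Finset ι) (k : ℕ) (x : ι → R) : R :=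
  (s.val.map x).esymm k

theorem esymmOn_zero [CommSemiring R] (s : Finset ι) (x : ι → R) : esymmOn s 0 x = 1 :=
  esymm_zero _

theorem esymmOn_insert [CommSemiring R] [DecidableEq ι] {s : Finset ι} {a : ι} (ha : a ∉ s)
    (k : ℕ) (x : ι → R) :
    esymmOn (insert a s) (k + 1) x = esymmOn s (k + 1) x + x a * esymmOn s k x := by
  simp only [esymmOn, Finset.insert_val_of_notMem ha, Multiset.map_cons, esymm_cons_succ]

theorem esymmOn_erase [CommSemiring R] [DecidableEq ι] {s : Finset ι} {a : ι} (ha : a ∈ s)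
    (k : ℕ) (x : ι → R) :
    esymmOn s (k + 1) x = esymmOn (s.erase a) (k + 1) x + x a * esymmOn (s.erase a) k x := by
  rw [← esymmOn_insert (Finset.notMem_erase a s), Finset.insert_erase ha]

theorem succ_mul_esymmOn_succ [CommSemiring R] [DecidableEq ι] (s : Finset ι) (k : ℕ)
    (x : ι → R) :
    (k + 1) * esymmOn s (k + 1) x = ∑ i ∈ s, x i * esymmOn (s.erase i) k x := by
  induction s using Finset.induction_on generalizing k with
  | empty => simp [esymmOn, esymm_eq_zero_of_card_lt (s := (0 : Multiset R)) k.succ_pos]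
  | insert a s ha ih =>
    rw [Finset.sum_insert ha, Finset.erase_insert ha, esymmOn_insert ha]
    cases k with
    | zero =>
      have ih₀ := ih 0
      simp only [esymmOn_zero, Nat.cast_zero, zero_add, one_mul, mul_one] at ih₀ ⊢
      rw [ih₀, add_comm]
    | succ k =>
      have hterm : ∑ i ∈ s, x i * esymmOn ((insert a s).erase i) (k + 1) x
          = ∑ i ∈ s, x i * esymmOn (s.erase i) (k + 1) x
            + x a * ∑ i ∈ s, x i * esymmOn (s.erase i) k x := by
        rw [Finset.mul_sum, ← Finset.sum_add_distrib]
        refine Finset.sum_congr rfl fun i hi => ?_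
        rw [Finset.erase_insert_of_ne (ne_of_mem_of_not_mem hi ha).symm,
          esymmOn_insert fun h => ha (Finset.mem_of_mem_erase h)]
        ring
      rw [hterm, ← ih (k + 1), ← ih k]
      push_cast
      ring

section Ordered

variable [Field K] [LinearOrder K] [IsStrictOrderedRing K]

theorem esymmOn_nonneg {x : ι → K} (hx : 0 ≤ x) (s : Finset ι) (k : ℕ) : 0 ≤ esymmOn s k x :=
  esymm_nonneg (Multiset.forall_mem_map_iff.2 fun i _ => hx i) k

theorem esymmOn_succ_eq_zero {x : ι → K} (hx : 0 ≤ x) {s : Finset ι} {k : ℕ}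
    (h : esymmOn s k x = 0) : esymmOn s (k + 1) x = 0 :=
  esymm_succ_eq_zero (Multiset.forall_mem_map_iff.2 fun i _ => hx i) h

/-- The ratio of consecutive elementary symmetric polynomials, which Marcus and Lopes proved to be
superadditive; it is `0` where the denominator vanishes. -/
def esymmRatio (s : Finset ι) (k : ℕ) (x : ι → K) : K :=
  esymmOn s (k + 1) x / esymmOn s k x

theorem esymmRatio_nonneg {x : ι → K} (hx : 0 ≤ x) (s : Finset ι) (k : ℕ) :
    0 ≤ esymmRatio s k x :=
  div_nonneg (esymmOn_nonneg hx s _) (esymmOn_nonneg hx s _)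

theorem esymmRatio_zero (s : Finset ι) (x : ι → K) : esymmRatio s 0 x = ∑ i ∈ s, x i := by
  classical
  simpa [esymmRatio, esymmOn_zero] using succ_mul_esymmOn_succ s 0 x

theorem esymmRatio_succ [DecidableEq ι] {x : ι → K} (hx : 0 ≤ x) (s : Finset ι) (k : ℕ) :
    (k + 2) * esymmRatio s (k + 1) x
      = ∑ i ∈ s, x i * esymmRatio (s.erase i) k x / (x i + esymmRatio (s.erase i) k x) := by
  have hEuler := succ_mul_esymmOn_succ s (k + 1) x
  push_cast at hEuler
  rw [esymmRatio, ← mul_div_assoc, show (k + 2 : K) = k + 1 + 1 by ring, hEuler, Finset.sum_div]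
  refine Finset.sum_congr rfl fun i hi => ?_
  rw [esymmOn_erase hi k x, esymmRatio]
  rcases (esymmOn_nonneg hx (s.erase i) k).eq_or_lt with hzero | hpos
  · simp [esymmOn_succ_eq_zero hx hzero.symm]
  · have hadd : x i + esymmOn (s.erase i) (k + 1) x / esymmOn (s.erase i) k x
        = (esymmOn (s.erase i) (k + 1) x + x i * esymmOn (s.erase i) k x)
          / esymmOn (s.erase i) k x := by
      field_simp
      ring
    rw [hadd, ← mul_div_assoc, div_div_div_cancel_right₀ hpos.ne']

theorem parallelSum_add_parallelSum_le {a b c d : K} (ha : 0 ≤ a) (hb : 0 ≤ b) (hc : 0 ≤ c)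
    (hd : 0 ≤ d) :
    a * b / (a + b) + c * d / (c + d) ≤ (a + c) * (b + d) / ((a + c) + (b + d)) := by
  rcases (add_nonneg ha hb).eq_or_lt with hab | hab
  · obtain ⟨rfl, rfl⟩ := (add_eq_zero_iff_of_nonneg ha hb).1 hab.symm
    simp
  rcases (add_nonneg hc hd).eq_or_lt with hcd | hcd
  · obtain ⟨rfl, rfl⟩ := (add_eq_zero_iff_of_nonneg hc hd).1 hcd.symm
    simp
  rw [div_add_div _ _ hab.ne' hcd.ne', div_le_div_iff₀ (by positivity) (by linarith)]
  nlinarith [sq_nonneg (a * d - b * c)]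

theorem parallelSum_le_parallelSum {a b c : K} (ha : 0 ≤ a) (hb : 0 ≤ b) (hbc : b ≤ c) :
    a * b / (a + b) ≤ a * c / (a + c) := by
  rcases ha.eq_or_lt with rfl | ha
  · simp
  rw [div_le_div_iff₀ (by linarith) (by linarith)]
  nlinarith [mul_pos ha ha]

theorem esymmRatio_add_esymmRatio_le {x y : ι → K} (hx : 0 ≤ x) (hy : 0 ≤ y) (s : Finset ι)
    (k : ℕ) : esymmRatio s k x + esymmRatio s k y ≤ esymmRatio s k (x + y) := by
  classical
  induction k generalizing s with
  | zero => simp [esymmRatio_zero, Finset.sum_add_distrib]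
  | succ k ih =>
    refine le_of_mul_le_mul_left ?_ (show (0 : K) < k + 2 by positivity)
    rw [mul_add, esymmRatio_succ hx, esymmRatio_succ hy, esymmRatio_succ (add_nonneg hx hy),
      ← Finset.sum_add_distrib]
    refine Finset.sum_le_sum fun i _ => ?_
    have hrx := esymmRatio_nonneg hx (s.erase i) k
    have hry := esymmRatio_nonneg hy (s.erase i) k
    exact (parallelSum_add_parallelSum_le (hx i) hrx (hy i) hry).trans
      (parallelSum_le_parallelSum (add_nonneg hx hy i) (add_nonneg hrx hry) (ih _))

theorem esymmOn_eq_prod_esymmRatio {x : ι → K} (hx : 0 ≤ x) (s : Finset ι) (k : ℕ) :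
    esymmOn s k x = ∏ j ∈ Finset.range k, esymmRatio s j x := by
  induction k with
  | zero => rw [esymmOn_zero, Finset.prod_range_zero]
  | succ k ih =>
    rw [Finset.prod_range_succ, ← ih, esymmRatio,
      mul_div_cancel_of_imp' fun h => esymmOn_succ_eq_zero hx h]

end Ordered

theorem prod_rpow_add_prod_rpow_le {s : Finset ι} {w a b : ι → ℝ} (hw : ∀ i ∈ s, 0 ≤ w i)
    (hw1 : ∑ i ∈ s, w i = 1) (ha : ∀ i ∈ s, 0 ≤ a i) (hb : ∀ i ∈ s, 0 ≤ b i) :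
    ∏ i ∈ s, a i ^ w i + ∏ i ∈ s, b i ^ w i ≤ ∏ i ∈ s, (a i + b i) ^ w i := by
  have hab : ∀ i ∈ s, 0 ≤ a i + b i := fun i hi => add_nonneg (ha i hi) (hb i hi)
  have amgm : ∀ c : ι → ℝ, (∀ i ∈ s, 0 ≤ c i) → (∀ i ∈ s, a i + b i = 0 → c i = 0) →
      ∏ i ∈ s, c i ^ w i
        ≤ (∑ i ∈ s, w i * (c i / (a i + b i))) * ∏ i ∈ s, (a i + b i) ^ w i := by
    intro c hc hc0
    have hquot : ∀ i ∈ s, 0 ≤ c i / (a i + b i) := fun i hi => div_nonneg (hc i hi) (hab i hi)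
    calc ∏ i ∈ s, c i ^ w i
        = (∏ i ∈ s, (c i / (a i + b i)) ^ w i) * ∏ i ∈ s, (a i + b i) ^ w i := by
          rw [← Finset.prod_mul_distrib]
          refine Finset.prod_congr rfl fun i hi => ?_
          rw [← Real.mul_rpow (hquot i hi) (hab i hi), div_mul_cancel_of_imp (hc0 i hi)]
      _ ≤ _ := by
          gcongr
          · exact Finset.prod_nonneg fun i hi => Real.rpow_nonneg (hab i hi) _
          · exact Real.geom_mean_le_arith_mean_weighted s w _ hw hw1 hquot
  have hsum : ∑ i ∈ s, w i * (a i / (a i + b i)) + ∑ i ∈ s, w i * (b i / (a i + b i)) ≤ 1 := by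
    rw [← Finset.sum_add_distrib, ← hw1]
    refine Finset.sum_le_sum fun i hi => ?_
    rw [← mul_add, ← add_div]
    exact mul_le_of_le_one_right (hw i hi) (div_self_le_one _)
  calc _ ≤ _ := add_le_add
        (amgm a ha fun i hi h => ((add_eq_zero_iff_of_nonneg (ha i hi) (hb i hi)).1 h).1)
        (amgm b hb fun i hi h => ((add_eq_zero_iff_of_nonneg (ha i hi) (hb i hi)).1 h).2)
    _ ≤ _ := by
        rw [← add_mul]
        exact mul_le_of_le_one_left
          (Finset.prod_nonneg fun i hi => Real.rpow_nonneg (hab i hi) _) hsum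

theorem esymmOn_rpow_add_esymmOn_rpow_le {k : ℕ} (hk : k ≠ 0) {x y : ι → ℝ} (hx : 0 ≤ x)
    (hy : 0 ≤ y) (s : Finset ι) :
    esymmOn s k x ^ (1 / (k : ℝ)) + esymmOn s k y ^ (1 / (k : ℝ))
      ≤ esymmOn s k (x + y) ^ (1 / (k : ℝ)) := by
  have hroot : ∀ z : ι → ℝ, 0 ≤ z → esymmOn s k z ^ (1 / (k : ℝ))
      = ∏ j ∈ Finset.range k, esymmRatio s j z ^ (1 / (k : ℝ)) := fun z hz => by
    rw [esymmOn_eq_prod_esymmRatio hz, Real.finsetProd_rpow _ _ fun j _ => esymmRatio_nonneg hz s j]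
  rw [hroot x hx, hroot y hy, hroot (x + y) (add_nonneg hx hy)]
  have hrx := esymmRatio_nonneg hx s
  have hry := esymmRatio_nonneg hy s
  refine (prod_rpow_add_prod_rpow_le (fun _ _ => by positivity) ?_ (fun j _ => hrx j)
    fun j _ => hry j).trans ?_
  · rw [Finset.sum_const, Finset.card_range, nsmul_eq_mul,
      mul_one_div_cancel (Nat.cast_ne_zero.2 hk)]
  · gcongr with j
    · exact fun j _ => Real.rpow_nonneg (add_nonneg (hrx j) (hry j)) _
    · exact add_nonneg (hrx j) (hry j)
    · exact esymmRatio_add_esymmRatio_le hx hy s j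

end EsymmOn

/-- A symmetric anti-norm in the sense of Bourin and Hiai: a positively homogeneous, superadditive
and symmetric function of nonnegative vectors. Symmetry is encoded by taking multisets as
arguments, superadditivity by multisets of pairs, and `zero_cons` makes the function independent of
the dimension of the space. -/
structure IsSymmAntiNorm (f : Multiset ℝ → ℝ) : Prop where
  superadditive (t : Multiset (ℝ × ℝ)) (ht : ∀ p ∈ t, 0 ≤ p) :
    f (t.map Prod.fst) + f (t.map Prod.snd) ≤ f (t.map fun p => p.1 + p.2)
  map_mul_left {c : ℝ} (hc : 0 ≤ c) {s : Multiset ℝ} (hs : ∀ x ∈ s, 0 ≤ x) :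
    f (s.map (c * ·)) = c * f s
  zero_cons (s : Multiset ℝ) : f (0 ::ₘ s) = f s

theorem isSymmAntiNorm_esymm_rpow {k : ℕ} (hk : k ≠ 0) :
    IsSymmAntiNorm fun s => s.esymm k ^ (1 / (k : ℝ)) where
  superadditive t ht := by
    have h := esymmOn_rpow_add_esymmOn_rpow_le hk (x := Prod.fst ∘ fun p : t => p.1)
      (y := Prod.snd ∘ fun p : t => p.1) (fun p => (ht _ (Multiset.coe_mem (x := p))).1)
      (fun p => (ht _ (Multiset.coe_mem (x := p))).2) Finset.univ
    have hadd : (Prod.fst ∘ fun p : t => p.1) + (Prod.snd ∘ fun p : t => p.1)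
        = (fun p : ℝ × ℝ => p.1 + p.2) ∘ fun p : t => p.1 := rfl
    simpa only [esymmOn, hadd, Multiset.map_univ_comp_coe] using h
  map_mul_left {c} hc {s} hs := by
    have h := Multiset.pow_smul_esymm c k s
    simp only [smul_eq_mul] at h
    rw [← h, Real.mul_rpow (pow_nonneg hc k) (esymm_nonneg hs k), one_div,
      Real.pow_rpow_inv_natCast hc hk]
  zero_cons s := by rw [esymm_zero_cons]

namespace IsSymmAntiNorm

variable {f : Multiset ℝ → ℝ} (hf : IsSymmAntiNorm f) {ι J : Type*} [Fintype ι]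

include hf

theorem replicate_zero_add (j : ℕ) (s : Multiset ℝ) : f (Multiset.replicate j 0 + s) = f s := by
  induction j with
  | zero => rw [Multiset.replicate_zero, zero_add]
  | succ j ih => rw [Multiset.replicate_succ, Multiset.cons_add, hf.zero_cons, ih]

theorem map_add_map_le {x y : ι → ℝ} (hx : 0 ≤ x) (hy : 0 ≤ y) :
    f (Finset.univ.val.map x) + f (Finset.univ.val.map y) ≤ f (Finset.univ.val.map (x + y)) := by
  have h := hf.superadditive (Finset.univ.val.map fun i => (x i, y i))
    (Multiset.forall_mem_map_iff.2 fun i _ => ⟨hx i, hy i⟩)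
  simp only [Multiset.map_map] at h
  exact h

theorem map_smul {c : ℝ} (hc : 0 ≤ c) {x : ι → ℝ} (hx : 0 ≤ x) :
    f (Finset.univ.val.map (c • x)) = c * f (Finset.univ.val.map x) := by
  rw [← hf.map_mul_left hc (Multiset.forall_mem_map_iff.2 fun i _ => hx i), Multiset.map_map]
  rfl

theorem sum_le (t : Finset J) {x : J → ι → ℝ} (hx : ∀ j, 0 ≤ x j) :
    ∑ j ∈ t, f (Finset.univ.val.map (x j)) ≤ f (Finset.univ.val.map (∑ j ∈ t, x j)) := by
  classical
  induction t using Finset.induction_on with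
  | empty =>
    have h := hf.map_smul le_rfl (le_refl (0 : ι → ℝ))
    rw [zero_smul, zero_mul] at h
    rw [Finset.sum_empty, Finset.sum_empty, h]
  | insert a t ha ih =>
    rw [Finset.sum_insert ha, Finset.sum_insert ha]
    exact (add_le_add_right ih _).trans
      (hf.map_add_map_le (hx a) (Finset.sum_nonneg fun j _ => hx j))

/-- Birkhoff's theorem turns superadditivity into Schur concavity. -/
theorem le_map_mulVec [DecidableEq ι] {D : Matrix ι ι ℝ} (hD : D ∈ doublyStochastic ℝ ι)
    {x : ι → ℝ} (hx : 0 ≤ x) :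
    f (Finset.univ.val.map x) ≤ f (Finset.univ.val.map (D *ᵥ x)) := by
  obtain ⟨w, hw, hw1, rfl⟩ := exists_eq_sum_perm_of_mem_doublyStochastic hD
  have hperm : ∀ σ : Equiv.Perm ι, 0 ≤ x ∘ σ := fun σ i => hx (σ i)
  calc f (Finset.univ.val.map x)
      = ∑ σ, w σ * f (Finset.univ.val.map x) := by rw [← Finset.sum_mul, hw1, one_mul]
    _ = ∑ σ, f (Finset.univ.val.map (w σ • (x ∘ σ))) := by
        refine Finset.sum_congr rfl fun σ _ => ?_
        rw [hf.map_smul (hw σ) (hperm σ), ← Multiset.map_map, Multiset.map_univ_val_equiv]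
    _ ≤ f (Finset.univ.val.map (∑ σ, w σ • (x ∘ σ))) :=
        hf.sum_le _ fun σ => smul_nonneg (hw σ) (hperm σ)
    _ = _ := by
        simp only [Matrix.sum_mulVec, Matrix.smul_mulVec, Matrix.permMatrix_mulVec]

end IsSymmAntiNorm

section Spectrum

open scoped ComplexOrder

variable {m n : Type*} [Fintype m] [Fintype n] [DecidableEq n]

/-- The real parts of the eigenvalues of a complex matrix with algebraic multiplicity. For a
Hermitian matrix this is its spectrum; no proof of hermiticity is part of the definition, so that
equal matrices can be rewritten in it. -/
noncomputable def realSpectrum (M : Matrix n n ℂ) : Multiset ℝ :=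
  M.charpoly.roots.map Complex.re

theorem realSpectrum_eq_map_eigenvalues {H : Matrix n n ℂ} (hH : H.IsHermitian) :
    realSpectrum H = Finset.univ.val.map hH.eigenvalues := by
  rw [realSpectrum, hH.roots_charpoly_eq_eigenvalues, Multiset.map_map]
  exact Multiset.map_congr rfl fun i _ => by simp

theorem nonneg_of_mem_realSpectrum {H : Matrix n n ℂ} (hH : H.PosSemidef) :
    ∀ x ∈ realSpectrum H, 0 ≤ x := by
  rw [realSpectrum_eq_map_eigenvalues hH.isHermitian]
  exact Multiset.forall_mem_map_iff.2 fun i _ => hH.eigenvalues_nonneg i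

theorem ofReal_sum_realSpectrum {H : Matrix n n ℂ} (hH : H.IsHermitian) :
    ((realSpectrum H).sum : ℂ) = H.trace := by
  rw [realSpectrum_eq_map_eigenvalues hH, hH.trace_eq_sum_eigenvalues]
  exact Complex.ofReal_sum _ _

theorem realSpectrum_unitary_mul_mul_conjTranspose {U : Matrix n n ℂ}
    (hU : U ∈ Matrix.unitaryGroup n ℂ) (M : Matrix n n ℂ) :
    realSpectrum (U * M * Uᴴ) = realSpectrum M := by
  have hUU : Uᴴ * U = 1 := Matrix.mem_unitaryGroup_iff'.1 hU
  rw [realSpectrum, Matrix.charpoly_mul_comm, ← Matrix.mul_assoc, hUU, Matrix.one_mul,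
    realSpectrum]

open Polynomial in
theorem realSpectrum_diagonal (x : n → ℝ) :
    realSpectrum (Matrix.diagonal fun i => (x i : ℂ)) = Finset.univ.val.map x := by
  rw [realSpectrum, Matrix.charpoly_diagonal, Polynomial.roots_prod _ _
    (Finset.prod_ne_zero_iff.2 fun i _ => X_sub_C_ne_zero _)]
  simp

theorem exists_unitary_eq_mul_diagonal_mul_conjTranspose {H : Matrix n n ℂ}
    (hH : H.IsHermitian) : ∃ U ∈ Matrix.unitaryGroup n ℂ,
      H = U * Matrix.diagonal (fun i => (hH.eigenvalues i : ℂ)) * Uᴴ := by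
  refine ⟨hH.eigenvectorUnitary, hH.eigenvectorUnitary.2, ?_⟩
  have h := hH.spectral_theorem
  rw [Unitary.conjStarAlgAut_apply] at h
  exact h

theorem realSpectrum_smul {H : Matrix n n ℂ} (hH : H.IsHermitian) (c : ℝ) :
    realSpectrum ((c : ℂ) • H) = (realSpectrum H).map (c * ·) := by
  obtain ⟨U, hU, hHU⟩ := exists_unitary_eq_mul_diagonal_mul_conjTranspose hH
  have hdiag : (c : ℂ) • H
      = U * Matrix.diagonal (fun i => ((c * hH.eigenvalues i : ℝ) : ℂ)) * Uᴴ := by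
    conv_lhs => rw [hHU]
    rw [← Matrix.smul_mul, ← Matrix.mul_smul, ← Matrix.diagonal_smul]
    simp only [Pi.smul_def, smul_eq_mul, Complex.ofReal_mul]
  rw [hdiag, realSpectrum_unitary_mul_mul_conjTranspose hU, realSpectrum_diagonal,
    realSpectrum_eq_map_eigenvalues hH, Multiset.map_map]
  rfl

open Polynomial in
theorem replicate_add_realSpectrum_mul_comm [DecidableEq m] (M : Matrix m n ℂ) (N : Matrix n m ℂ) :
    Multiset.replicate (Fintype.card n) 0 + realSpectrum (M * N)
      = Multiset.replicate (Fintype.card m) 0 + realSpectrum (N * M) := by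
  have hne : ∀ (k : ℕ) {p : ℂ[X]}, p.Monic → X ^ k * p ≠ 0 := fun k p hp =>
    mul_ne_zero (pow_ne_zero k X_ne_zero) hp.ne_zero
  have h := congrArg (fun p => p.roots.map Complex.re) (Matrix.charpoly_mul_comm' M N)
  simp only [roots_mul (hne _ (Matrix.charpoly_monic _)), roots_X_pow,
    Multiset.nsmul_singleton, Multiset.map_add, Multiset.map_replicate, Complex.zero_re] at h
  exact h

theorem of_normSq_mem_doublyStochastic {W : Matrix n n ℂ} (hW : W ∈ Matrix.unitaryGroup n ℂ) :
    Matrix.of (fun i j => Complex.normSq (W i j)) ∈ doublyStochastic ℝ n := by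
  rw [mem_doublyStochastic_iff_sum]
  refine ⟨fun i j => Complex.normSq_nonneg _, fun i => ?_, fun j => ?_⟩
  · have hrow := congrFun (congrFun (Matrix.mem_unitaryGroup_iff.1 hW) i) i
    simp only [Matrix.mul_apply, Matrix.star_apply, Matrix.one_apply_eq, Complex.star_def,
      Complex.mul_conj] at hrow
    exact_mod_cast hrow
  · have hcol := congrFun (congrFun (Matrix.mem_unitaryGroup_iff'.1 hW) j) j
    simp only [Matrix.mul_apply, Matrix.star_apply, Matrix.one_apply_eq, Complex.star_def,
      Complex.normSq_eq_conj_mul_self.symm] at hcol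
    exact_mod_cast hcol

theorem re_mul_diagonal_mul_conjTranspose_apply_self (W : Matrix n n ℂ) (x : n → ℝ) (i : n) :
    ((W * Matrix.diagonal (fun j => (x j : ℂ)) * Wᴴ) i i).re
      = (Matrix.of (fun i j => Complex.normSq (W i j)) *ᵥ x) i := by
  rw [Matrix.mul_apply, Complex.re_sum]
  simp only [Matrix.mul_diagonal, Matrix.conjTranspose_apply, Matrix.mulVec, dotProduct,
    Matrix.of_apply]
  refine Finset.sum_congr rfl fun j _ => ?_
  rw [mul_right_comm, Complex.star_def, Complex.mul_conj, ← Complex.ofReal_mul,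
    Complex.ofReal_re]

namespace IsSymmAntiNorm

variable {f : Multiset ℝ → ℝ} (hf : IsSymmAntiNorm f)

include hf

theorem realSpectrum_mul_comm [DecidableEq m] (M : Matrix m n ℂ) (N : Matrix n m ℂ) :
    f (realSpectrum (M * N)) = f (realSpectrum (N * M)) := by
  rw [← hf.replicate_zero_add (Fintype.card n), replicate_add_realSpectrum_mul_comm,
    hf.replicate_zero_add]

/-- By the Schur–Horn theorem the diagonal is a doubly stochastic image of the spectrum. -/
theorem realSpectrum_le_diag {H : Matrix n n ℂ} (hH : H.PosSemidef) :
    f (realSpectrum H) ≤ f (Finset.univ.val.map fun i => (H i i).re) := by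
  obtain ⟨U, hU, hHU⟩ := exists_unitary_eq_mul_diagonal_mul_conjTranspose hH.isHermitian
  have hdiag : (fun i => (H i i).re)
      = Matrix.of (fun i j => Complex.normSq (U i j)) *ᵥ hH.isHermitian.eigenvalues := by
    funext i
    rw [← re_mul_diagonal_mul_conjTranspose_apply_self, ← hHU]
  rw [hdiag, realSpectrum_eq_map_eigenvalues hH.isHermitian]
  exact hf.le_map_mulVec (of_normSq_mem_doublyStochastic hU) hH.eigenvalues_nonneg

theorem sum_realSpectrum_le {I : Type*} [Fintype I] {H : I → Matrix n n ℂ}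
    (hH : ∀ i, (H i).PosSemidef) :
    ∑ i, f (realSpectrum (H i)) ≤ f (realSpectrum (∑ i, H i)) := by
  have hS : (∑ i, H i).IsHermitian :=
    (Matrix.posSemidef_sum _ fun i _ => hH i).isHermitian
  obtain ⟨U, hU, hSU⟩ := exists_unitary_eq_mul_diagonal_mul_conjTranspose hS
  have hUU : Uᴴ * U = 1 := Matrix.mem_unitaryGroup_iff'.1 hU
  have hpos : ∀ i, (Uᴴ * H i * U).PosSemidef := fun i => (hH i).conjTranspose_mul_mul_same U
  have hconj : ∀ i, realSpectrum (Uᴴ * H i * U) = realSpectrum (H i) := fun i => by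
    have h := realSpectrum_unitary_mul_mul_conjTranspose (Unitary.star_mem hU) (H i)
    rwa [Matrix.star_eq_conjTranspose, Matrix.conjTranspose_conjTranspose] at h
  have hdiag : ∑ i, (fun j => ((Uᴴ * H i * U) j j).re) = hS.eigenvalues := by
    funext j
    calc (∑ i, fun j => ((Uᴴ * H i * U) j j).re) j = ((Uᴴ * (∑ i, H i) * U) j j).re := by
          rw [Matrix.mul_sum, Matrix.sum_mul, Matrix.sum_apply, Complex.re_sum, Finset.sum_apply]
      _ = (Matrix.diagonal (fun i => (hS.eigenvalues i : ℂ)) j j).re := by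
          conv_lhs => rw [hSU]
          simp only [← Matrix.mul_assoc, hUU, Matrix.one_mul]
          rw [Matrix.mul_assoc, hUU, Matrix.mul_one]
      _ = _ := by rw [Matrix.diagonal_apply_eq, Complex.ofReal_re]
  calc ∑ i, f (realSpectrum (H i))
      ≤ ∑ i, f (Finset.univ.val.map fun j => ((Uᴴ * H i * U) j j).re) :=
        Finset.sum_le_sum fun i _ => hconj i ▸ hf.realSpectrum_le_diag (hpos i)
    _ ≤ f (Finset.univ.val.map (∑ i, fun j => ((Uᴴ * H i * U) j j).re)) :=
        hf.sum_le _ fun i j => (Complex.nonneg_iff.1 (hpos i).diag_nonneg).1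
    _ = _ := by rw [hdiag, realSpectrum_eq_map_eigenvalues hS]

theorem realSpectrum_smul_mul_conjTranspose (c : ℂ) (M : Matrix n m ℂ) :
    f (realSpectrum ((c • M) * (c • M)ᴴ)) = Complex.normSq c * f (realSpectrum (M * Mᴴ)) := by
  have hM : (M * Mᴴ).PosSemidef := Matrix.posSemidef_self_mul_conjTranspose M
  have hsmul : (c • M) * (c • M)ᴴ = (Complex.normSq c : ℂ) • (M * Mᴴ) := by
    rw [Matrix.conjTranspose_smul, Matrix.smul_mul, Matrix.mul_smul, smul_smul, Complex.star_def,
      Complex.mul_conj]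
  rw [hsmul, realSpectrum_smul hM.isHermitian]
  exact hf.map_mul_left (Complex.normSq_nonneg c) (nonneg_of_mem_realSpectrum hM)

theorem sum_realSpectrum_mul_left_le {I : Type*} [Fintype I] {n' : I → Type*}
    [∀ i, Fintype (n' i)] [∀ i, DecidableEq (n' i)] (K : ∀ i, Matrix (n' i) n ℂ)
    (hK : ∑ i, (K i)ᴴ * K i = 1) (M : Matrix n m ℂ) :
    ∑ i, f (realSpectrum ((K i * M) * (K i * M)ᴴ)) ≤ f (realSpectrum (M * Mᴴ)) := by
  classical
  have hsum : ∑ i, (K i * M)ᴴ * (K i * M) = Mᴴ * M := by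
    calc ∑ i, (K i * M)ᴴ * (K i * M) = ∑ i, Mᴴ * ((K i)ᴴ * K i) * M := by
          simp only [Matrix.conjTranspose_mul, Matrix.mul_assoc]
      _ = Mᴴ * M := by rw [← Matrix.sum_mul, ← Matrix.mul_sum, hK, Matrix.mul_one]
  simp only [fun i => hf.realSpectrum_mul_comm (K i * M) (K i * M)ᴴ]
  rw [hf.realSpectrum_mul_comm M, ← hsum]
  exact hf.sum_realSpectrum_le fun i => Matrix.posSemidef_conjTranspose_mul_self _

theorem sum_realSpectrum_mul_right_le [DecidableEq m] {I : Type*} [Fintype I] {n' : I → Type*}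
    [∀ i, Fintype (n' i)] (K : ∀ i, Matrix (n' i) n ℂ) (hK : ∑ i, (K i)ᴴ * K i = 1)
    (M : Matrix m n ℂ) :
    ∑ i, f (realSpectrum ((M * (K i)ᵀ) * (M * (K i)ᵀ)ᴴ)) ≤ f (realSpectrum (M * Mᴴ)) := by
  have hsum : ∑ i, (M * (K i)ᵀ) * (M * (K i)ᵀ)ᴴ = M * Mᴴ := by
    calc ∑ i, (M * (K i)ᵀ) * (M * (K i)ᵀ)ᴴ = ∑ i, M * ((K i)ᴴ * K i)ᵀ * Mᴴ := by
          simp only [Matrix.conjTranspose_mul, Matrix.transpose_mul, Matrix.mul_assoc]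
          rfl
      _ = M * Mᴴ := by
          rw [← Matrix.sum_mul, ← Matrix.mul_sum, ← Matrix.transpose_sum, hK,
            Matrix.transpose_one, Matrix.mul_one]
  rw [← hsum]
  exact hf.sum_realSpectrum_le fun i => Matrix.posSemidef_self_mul_conjTranspose _

end IsSymmAntiNorm

end Spectrum

section PureEnsemble

open Matrix

theorem mul_vecMulVec_star_mul_conjTranspose {m n : Type*} [Fintype n] (X : Matrix m n ℂ)
    (v : n → ℂ) :
    X * vecMulVec v (star v) * Xᴴ = vecMulVec (X *ᵥ v) (star (X *ᵥ v)) := by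
  rw [mul_vecMulVec, vecMulVec_mul, star_mulVec]

variable {J n : Type*} [Fintype J] {u : J → n → ℂ} {v : n → ℂ}

theorem sum_normSq_dotProduct_eq [Fintype n]
    (h : ∑ j, vecMulVec (u j) (star (u j)) = vecMulVec v (star v)) (x : n → ℂ) :
    ∑ j, Complex.normSq (x ⬝ᵥ u j) = Complex.normSq (x ⬝ᵥ v) := by
  have hquad : ∀ w : n → ℂ,
      x ⬝ᵥ (vecMulVec w (star w) *ᵥ star x) = (Complex.normSq (x ⬝ᵥ w) : ℂ) := fun w => by
    rw [vecMulVec_mulVec, star_dotProduct_star, dotProduct_smul, op_smul_eq_mul,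
      Complex.star_def, Complex.mul_conj]
  have hform := congrArg (fun M => x ⬝ᵥ (M *ᵥ star x)) h
  simp only [sum_mulVec, dotProduct_sum, hquad] at hform
  exact_mod_cast hform

/-- Testing against `x = v q • e_p - v p • e_q`, which is orthogonal to `v`, shows that every `u j`
is proportional to `v`. -/
theorem exists_eq_smul_of_sum_vecMulVec_eq [Finite n] (hv : v ≠ 0)
    (h : ∑ j, vecMulVec (u j) (star (u j)) = vecMulVec v (star v)) :
    ∃ c : J → ℂ, (∀ j, u j = c j • v) ∧ ∑ j, Complex.normSq (c j) = 1 := by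
  classical
  cases nonempty_fintype n
  obtain ⟨q, hq⟩ := Function.ne_iff.1 hv
  rw [Pi.zero_apply] at hq
  have hprop : ∀ j p, v q * u j p = v p * u j q := fun j p => by
    have hsum := sum_normSq_dotProduct_eq h (Pi.single p (v q) - Pi.single q (v p))
    simp only [sub_dotProduct, single_dotProduct, mul_comm (v p) (v q), sub_self,
      Complex.normSq_zero] at hsum
    have hj := (Finset.sum_eq_zero_iff_of_nonneg fun j _ => Complex.normSq_nonneg _).1 hsum j
      (Finset.mem_univ j)
    exact sub_eq_zero.1 (Complex.normSq_eq_zero.1 hj)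
  refine ⟨fun j => u j q / v q, fun j => ?_, ?_⟩
  · funext p
    rw [Pi.smul_apply, smul_eq_mul, div_mul_eq_mul_div, eq_div_iff hq, mul_comm, hprop, mul_comm]
  · have hnorm := sum_normSq_dotProduct_eq h (Pi.single q 1)
    simp only [single_dotProduct, one_mul] at hnorm
    simp only [Complex.normSq_div, ← Finset.sum_div]
    rw [hnorm, div_self (mt Complex.normSq_eq_zero.1 hq)]

end PureEnsemble

namespace PureState

variable {A B : Type} [Fintype A] [Fintype B] (ζ : PureState A B)

theorem amp_ne_zero : ζ.amp ≠ 0 := fun h => by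
  simpa [h] using ζ.normalized

variable [DecidableEq A]

theorem schmidtCoeffs_eq_realSpectrum : ζ.schmidtCoeffs = realSpectrum (ζ.amp * ζ.ampᴴ) := by
  rw [schmidtCoeffs, ← realSpectrum_eq_map_eigenvalues, reduced_eq]

open scoped ComplexOrder in
theorem schmidtCoeffs_nonneg : ∀ x ∈ ζ.schmidtCoeffs, 0 ≤ x := by
  rw [schmidtCoeffs_eq_realSpectrum]
  exact nonneg_of_mem_realSpectrum (Matrix.posSemidef_self_mul_conjTranspose _)

theorem sum_schmidtCoeffs : ζ.schmidtCoeffs.sum = 1 := by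
  have htrace : ζ.reduced.trace = 1 := by
    calc ζ.reduced.trace = ((∑ a, ∑ b, ‖ζ.amp a b‖ ^ 2 : ℝ) : ℂ) := by
          simp [Matrix.trace, reduced, density, Complex.mul_conj, Complex.normSq_eq_norm_sq]
      _ = 1 := by rw [ζ.normalized, Complex.ofReal_one]
  have hsum := ofReal_sum_realSpectrum ζ.reduced_isHermitian
  rw [htrace, reduced_eq, ← schmidtCoeffs_eq_realSpectrum] at hsum
  exact_mod_cast hsum

theorem schmidtRank_ne_zero : ζ.schmidtRank ≠ 0 := fun h => by
  rw [schmidtRank, Multiset.card_eq_zero, Multiset.filter_eq_nil] at h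
  have hsum : ζ.schmidtCoeffs.sum = 0 :=
    Multiset.sum_eq_zero fun x hx => not_not.1 (h x hx)
  exact one_ne_zero (ζ.sum_schmidtCoeffs.symm.trans hsum)

end PureState

section LOCC

/-- The rank-one operator `|M⟩⟨M|` of the, not necessarily normalised, bipartite vector with
amplitudes `M`. -/
def ampDensity {A B : Type*} (M : Matrix A B ℂ) : Matrix (A × B) (A × B) ℂ :=
  Matrix.vecMulVec (Function.uncurry M) (star (Function.uncurry M))

section AmpDensity

variable {A B C : Type*} [Fintype A] [Fintype B]

theorem kronecker_one_mul_ampDensity_mul_conjTranspose [DecidableEq B] (K : Matrix C A ℂ)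
    (M : Matrix A B ℂ) :
    (K ⊗ₖ (1 : Matrix B B ℂ)) * ampDensity M * (K ⊗ₖ (1 : Matrix B B ℂ))ᴴ
      = ampDensity (K * M) := by
  have hvec : (K ⊗ₖ (1 : Matrix B B ℂ)) *ᵥ Function.uncurry M = Function.uncurry (K * M) := by
    funext p
    simp [Function.uncurry, Matrix.mulVec, dotProduct, Fintype.sum_prod_type, Matrix.mul_apply,
      Matrix.one_apply]
  rw [ampDensity, mul_vecMulVec_star_mul_conjTranspose, hvec, ampDensity]

theorem one_kronecker_mul_ampDensity_mul_conjTranspose [DecidableEq A] (K : Matrix C B ℂ)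
    (M : Matrix A B ℂ) :
    ((1 : Matrix A A ℂ) ⊗ₖ K) * ampDensity M * ((1 : Matrix A A ℂ) ⊗ₖ K)ᴴ
      = ampDensity (M * Kᵀ) := by
  have hvec : ((1 : Matrix A A ℂ) ⊗ₖ K) *ᵥ Function.uncurry M = Function.uncurry (M * Kᵀ) := by
    funext p
    simp [Function.uncurry, Matrix.mulVec, dotProduct, Fintype.sum_prod_type_right,
      Matrix.mul_apply, Matrix.one_apply, mul_comm]
  rw [ampDensity, mul_vecMulVec_star_mul_conjTranspose, hvec, ampDensity]

end AmpDensity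

variable {A B A₂ B₂ : Type} [Fintype A] [Fintype B] [Fintype A₂] [Fintype B₂] [DecidableEq A]
  [DecidableEq B] [DecidableEq A₂] [DecidableEq B₂]

theorem IsLOCC.exists_ensemble {f : Multiset ℝ → ℝ} (hf : IsSymmAntiNorm f)
    {Λ : Matrix (A × B) (A × B) ℂ → Matrix (A₂ × B₂) (A₂ × B₂) ℂ} (hΛ : IsLOCC A₂ B₂ A B Λ)
    (M : Matrix A B ℂ) :
    ∃ (J : Type) (_ : Fintype J) (N : J → Matrix A₂ B₂ ℂ),
      Λ (ampDensity M) = ∑ j, ampDensity (N j) ∧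
        ∑ j, f (realSpectrum (N j * (N j)ᴴ)) ≤ f (realSpectrum (M * Mᴴ)) := by
  induction hΛ with
  | done => exact ⟨Unit, inferInstance, fun _ => M, by simp, by simp⟩
  | alice K hK Λ _ ih =>
    choose J _ N hN hle using fun i => ih i (K i * M)
    refine ⟨Σ i, J i, inferInstance, fun j => N j.1 j.2, ?_, ?_⟩
    · simp only [kronecker_one_mul_ampDensity_mul_conjTranspose, hN, Fintype.sum_sigma]
    · rw [Fintype.sum_sigma]
      exact (Finset.sum_le_sum fun i _ => hle i).trans (hf.sum_realSpectrum_mul_left_le K hK M)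
  | bob K hK Λ _ ih =>
    choose J _ N hN hle using fun i => ih i (M * (K i)ᵀ)
    refine ⟨Σ i, J i, inferInstance, fun j => N j.1 j.2, ?_, ?_⟩
    · simp only [one_kronecker_mul_ampDensity_mul_conjTranspose, hN, Fintype.sum_sigma]
    · rw [Fintype.sum_sigma]
      exact (Finset.sum_le_sum fun i _ => hle i).trans (hf.sum_realSpectrum_mul_right_le K hK M)

theorem LOCCConvertible.map_schmidtCoeffs_le {f : Multiset ℝ → ℝ} (hf : IsSymmAntiNorm f)
    {ψ : PureState A B} {φ : PureState A₂ B₂} (h : LOCCConvertible ψ φ) :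
    f φ.schmidtCoeffs ≤ f ψ.schmidtCoeffs := by
  obtain ⟨Λ, hΛ, hmap⟩ := h
  obtain ⟨J, _, N, hN, hle⟩ := hΛ.exists_ensemble hf ψ.amp
  have hmix : ∑ j, ampDensity (N j) = ampDensity φ.amp := hN.symm.trans hmap
  have hφ : Function.uncurry φ.amp ≠ 0 := fun h₀ =>
    φ.amp_ne_zero (Matrix.ext fun a b => congrFun h₀ (a, b))
  obtain ⟨c, hc, hc1⟩ := exists_eq_smul_of_sum_vecMulVec_eq hφ hmix
  have hNc : ∀ j, N j = c j • φ.amp := fun j => Matrix.ext fun a b => congrFun (hc j) (a, b)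
  rw [φ.schmidtCoeffs_eq_realSpectrum, ψ.schmidtCoeffs_eq_realSpectrum]
  simpa only [hNc, hf.realSpectrum_smul_mul_conjTranspose, ← Finset.sum_mul, hc1, one_mul]
    using hle

theorem LOCCConvertible.esymm_schmidtCoeffs_le {ψ : PureState A B} {φ : PureState A₂ B₂}
    (h : LOCCConvertible ψ φ) (k : ℕ) : φ.schmidtCoeffs.esymm k ≤ ψ.schmidtCoeffs.esymm k := by
  rcases eq_or_ne k 0 with rfl | hk
  · rw [esymm_zero, esymm_zero]
  · exact (Real.rpow_le_rpow_iff (esymm_nonneg φ.schmidtCoeffs_nonneg k)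
      (esymm_nonneg ψ.schmidtCoeffs_nonneg k) (by positivity)).1
        (h.map_schmidtCoeffs_le (isSymmAntiNorm_esymm_rpow hk))

end LOCC

section MulProduct

variable {R : Type*}

/-- The multiset of all products of an element of `s` and an element of `t`; these are the
eigenvalues of a Kronecker product whose factors have eigenvalues `s` and `t`. -/
def mulProduct [Mul R] (s t : Multiset R) : Multiset R :=
  s.bind fun a => t.map (a * ·)

theorem zero_mulProduct [Mul R] (t : Multiset R) : mulProduct 0 t = 0 :=
  Multiset.zero_bind _

theorem cons_mulProduct [Mul R] (a : R) (s t : Multiset R) :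
    mulProduct (a ::ₘ s) t = t.map (a * ·) + mulProduct s t :=
  Multiset.cons_bind _ _ _

theorem card_mulProduct [Mul R] (s t : Multiset R) :
    (mulProduct s t).card = s.card * t.card := by
  simp [mulProduct, Multiset.card_bind]

theorem filter_ne_zero_mulProduct [MulZeroClass R] [NoZeroDivisors R] [DecidableEq R]
    (s t : Multiset R) :
    (mulProduct s t).filter (· ≠ 0) = mulProduct (s.filter (· ≠ 0)) (t.filter (· ≠ 0)) := by
  induction s using Multiset.induction_on with
  | empty => simp only [zero_mulProduct, Multiset.filter_zero]
  | cons a s ih =>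
    rw [cons_mulProduct, Multiset.filter_add, Multiset.filter_map, ih]
    rcases eq_or_ne a 0 with rfl | ha
    · simp
    · rw [Multiset.filter_cons_of_pos (p := (· ≠ 0)) _ ha, cons_mulProduct]
      simp [ha]

theorem prod_mulProduct [CommMonoid R] (s t : Multiset R) :
    (mulProduct s t).prod = s.prod ^ t.card * t.prod ^ s.card := by
  have hscale : ∀ a, (t.map (a * ·)).prod = a ^ t.card * t.prod := fun a => by
    rw [Multiset.prod_map_mul, Multiset.map_const', Multiset.prod_replicate, Multiset.map_id']
  simp only [mulProduct, Multiset.prod_bind, hscale]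
  rw [Multiset.prod_map_mul, Multiset.prod_map_pow, Multiset.map_id', Multiset.map_const',
    Multiset.prod_replicate]

theorem sum_inv_mulProduct [Semifield R] (s t : Multiset R) :
    ((mulProduct s t).map (·⁻¹)).sum = (s.map (·⁻¹)).sum * (t.map (·⁻¹)).sum := by
  simp only [mulProduct, Multiset.map_bind, Multiset.sum_bind, Multiset.map_map,
    Function.comp_def, mul_inv, Multiset.sum_map_mul_left, Multiset.sum_map_mul_right]

theorem esymm_mulProduct_card_mul_card [CommSemiring R] (s t : Multiset R) :
    (mulProduct s t).esymm (s.card * t.card)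
      = s.esymm s.card ^ t.card * t.esymm t.card ^ s.card := by
  rw [← card_mulProduct, esymm_card, prod_mulProduct, esymm_card, esymm_card]

theorem esymm_mulProduct_card_mul_card_sub_one [Field R] {s t : Multiset R}
    (hs : ∀ x ∈ s, x ≠ 0) (ht : ∀ y ∈ t, y ≠ 0) (hs₀ : s.card ≠ 0) (ht₀ : t.card ≠ 0) :
    (mulProduct s t).esymm (s.card * t.card - 1)
      = s.esymm s.card ^ (t.card - 1) * s.esymm (s.card - 1)
        * (t.esymm t.card ^ (s.card - 1) * t.esymm (t.card - 1)) := by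
  have hst : ∀ z ∈ mulProduct s t, z ≠ 0 := fun z hz => by
    obtain ⟨x, hx, hz⟩ := Multiset.mem_bind.1 hz
    obtain ⟨y, hy, rfl⟩ := Multiset.mem_map.1 hz
    exact mul_ne_zero (hs x hx) (ht y hy)
  have hcard : (mulProduct s t).card ≠ 0 := by
    rw [card_mulProduct]
    exact mul_ne_zero hs₀ ht₀
  rw [← card_mulProduct, esymm_card_sub_one hst hcard, prod_mulProduct, sum_inv_mulProduct,
    esymm_card_sub_one hs hs₀, esymm_card_sub_one ht ht₀, esymm_card, esymm_card,
    ← pow_sub_one_mul ht₀, ← pow_sub_one_mul hs₀ t.prod]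
  ring

end MulProduct

theorem realSpectrum_kronecker {m n : Type*} [Fintype m] [Fintype n] [DecidableEq m]
    [DecidableEq n] {H : Matrix m m ℂ} {L : Matrix n n ℂ} (hH : H.IsHermitian)
    (hL : L.IsHermitian) :
    realSpectrum (H ⊗ₖ L) = mulProduct (realSpectrum H) (realSpectrum L) := by
  obtain ⟨U, hU, hHU⟩ := exists_unitary_eq_mul_diagonal_mul_conjTranspose hH
  obtain ⟨V, hV, hLV⟩ := exists_unitary_eq_mul_diagonal_mul_conjTranspose hL
  have hdiag : H ⊗ₖ L = (U ⊗ₖ V)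
      * Matrix.diagonal (fun p : m × n => ((hH.eigenvalues p.1 * hL.eigenvalues p.2 : ℝ) : ℂ))
      * (U ⊗ₖ V)ᴴ := by
    conv_lhs => rw [hHU, hLV]
    simp only [Matrix.mul_kronecker_mul, Matrix.conjTranspose_kronecker,
      Matrix.diagonal_kronecker_diagonal, Complex.ofReal_mul]
  have huniv : (Finset.univ : Finset (m × n)).val
      = Finset.univ.val.product Finset.univ.val := rfl
  rw [hdiag, realSpectrum_unitary_mul_mul_conjTranspose (Matrix.kronecker_mem_unitary hU hV),
    realSpectrum_diagonal, realSpectrum_eq_map_eigenvalues hH, realSpectrum_eq_map_eigenvalues hL,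
    huniv]
  simp only [mulProduct, Multiset.product, Multiset.map_bind, Multiset.bind_map,
    Multiset.map_map, Function.comp_def]

theorem esymm_replicate_one_div_pos {n k : ℕ} (hkn : k ≤ n) :
    0 < (Multiset.replicate n (1 / (n : ℝ))).esymm k := by
  refine esymm_pos (fun x hx => ?_) (by rwa [Multiset.card_replicate])
  obtain ⟨hn, rfl⟩ := Multiset.mem_replicate.1 hx
  positivity

namespace PureState

variable {A B A' B' : Type} [Fintype A] [Fintype B] [Fintype A'] [Fintype B'] [DecidableEq A]

theorem esymm_schmidtCoeffs_pos (ζ : PureState A B) {k : ℕ} (hk : k ≤ ζ.schmidtRank) :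
    0 < ζ.schmidtCoeffs.esymm k := by
  rw [← esymm_filter_ne_zero]
  refine esymm_pos (fun x hx => ?_) hk
  rw [Multiset.mem_filter] at hx
  exact (ζ.schmidtCoeffs_nonneg x hx.1).lt_of_ne' hx.2

theorem concurrence_pos (ζ : PureState A B) {n k : ℕ} (hkn : k ≤ n) (hk : k ≤ ζ.schmidtRank) :
    0 < ζ.concurrence n k :=
  Real.rpow_pos_of_pos (div_pos (ζ.esymm_schmidtCoeffs_pos hk) (esymm_replicate_one_div_pos hkn)) _

theorem natCast_mul_log_concurrence (ζ : PureState A B) {n k : ℕ} (hkn : k ≤ n)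
    (hk : k ≤ ζ.schmidtRank) :
    k * Real.log (ζ.concurrence n k)
      = Real.log (ζ.schmidtCoeffs.esymm k)
        - Real.log ((Multiset.replicate n (1 / (n : ℝ))).esymm k) := by
  rcases eq_or_ne k 0 with rfl | hk₀
  · simp [esymm_zero]
  have hζ : 0 < ζ.schmidtCoeffs.esymm k := ζ.esymm_schmidtCoeffs_pos hk
  have huniform : 0 < (Multiset.replicate n (1 / (n : ℝ))).esymm k :=
    esymm_replicate_one_div_pos hkn
  rw [concurrence, Real.log_rpow (div_pos hζ huniform), ← mul_assoc,
    mul_one_div_cancel (Nat.cast_ne_zero.2 hk₀), one_mul, Real.log_div hζ.ne' huniform.ne']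

theorem natCast_mul_log_concurrence_sub {A₂ B₂ : Type} [Fintype A₂] [Fintype B₂] [DecidableEq A₂]
    (ζ : PureState A B) (ξ : PureState A₂ B₂) {n k : ℕ} (hkn : k ≤ n) (hζ : k ≤ ζ.schmidtRank)
    (hξ : k ≤ ξ.schmidtRank) :
    k * (Real.log (ζ.concurrence n k) - Real.log (ξ.concurrence n k))
      = Real.log (ζ.schmidtCoeffs.esymm k) - Real.log (ξ.schmidtCoeffs.esymm k) := by
  rw [mul_sub, ζ.natCast_mul_log_concurrence hkn hζ, ξ.natCast_mul_log_concurrence hkn hξ,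
    sub_sub_sub_cancel_right]

variable [DecidableEq A'] (ψ : PureState A B) (χ : PureState A' B')

theorem schmidtCoeffs_tensor :
    (ψ.tensor χ).schmidtCoeffs = mulProduct ψ.schmidtCoeffs χ.schmidtCoeffs := by
  have hamp : (ψ.tensor χ).amp * (ψ.tensor χ).ampᴴ
      = (ψ.amp * ψ.ampᴴ) ⊗ₖ (χ.amp * χ.ampᴴ) := by
    rw [tensor, Matrix.conjTranspose_kronecker, Matrix.mul_kronecker_mul]
  simp only [schmidtCoeffs_eq_realSpectrum]
  rw [hamp, realSpectrum_kronecker (Matrix.isHermitian_mul_conjTranspose_self _)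
    (Matrix.isHermitian_mul_conjTranspose_self _)]

theorem esymm_schmidtCoeffs_tensor (k : ℕ) :
    (ψ.tensor χ).schmidtCoeffs.esymm k
      = (mulProduct (ψ.schmidtCoeffs.filter (· ≠ 0)) (χ.schmidtCoeffs.filter (· ≠ 0))).esymm k := by
  rw [← filter_ne_zero_mulProduct, esymm_filter_ne_zero, schmidtCoeffs_tensor]

theorem esymm_schmidtCoeffs_tensor_mul_schmidtRank :
    (ψ.tensor χ).schmidtCoeffs.esymm (ψ.schmidtRank * χ.schmidtRank)
      = ψ.schmidtCoeffs.esymm ψ.schmidtRank ^ χ.schmidtRank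
        * χ.schmidtCoeffs.esymm χ.schmidtRank ^ ψ.schmidtRank := by
  have h := esymm_mulProduct_card_mul_card (ψ.schmidtCoeffs.filter (· ≠ 0))
    (χ.schmidtCoeffs.filter (· ≠ 0))
  rw [← esymm_schmidtCoeffs_tensor] at h
  simp only [esymm_filter_ne_zero] at h
  exact h

theorem esymm_schmidtCoeffs_tensor_mul_schmidtRank_sub_one :
    (ψ.tensor χ).schmidtCoeffs.esymm (ψ.schmidtRank * χ.schmidtRank - 1)
      = ψ.schmidtCoeffs.esymm ψ.schmidtRank ^ (χ.schmidtRank - 1)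
          * ψ.schmidtCoeffs.esymm (ψ.schmidtRank - 1)
        * (χ.schmidtCoeffs.esymm χ.schmidtRank ^ (ψ.schmidtRank - 1)
          * χ.schmidtCoeffs.esymm (χ.schmidtRank - 1)) := by
  have h := esymm_mulProduct_card_mul_card_sub_one
    (fun _ hx => (Multiset.mem_filter.1 hx).2) (fun _ hy => (Multiset.mem_filter.1 hy).2)
    ψ.schmidtRank_ne_zero χ.schmidtRank_ne_zero
  rw [← esymm_schmidtCoeffs_tensor] at h
  simp only [esymm_filter_ne_zero] at h
  exact h

end PureState

section Catalysis

variable {A B A₂ B₂ A' B' : Type} [Fintype A] [DecidableEq A] [Fintype B] [DecidableEq B]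
  [Fintype A₂] [DecidableEq A₂] [Fintype B₂] [DecidableEq B₂] [Fintype A'] [DecidableEq A']
  [Fintype B'] [DecidableEq B'] {ψ : PureState A B} {φ : PureState A₂ B₂} {χ : PureState A' B'}

theorem LOCCConvertible.esymm_schmidtRank_le_of_tensor
    (h : LOCCConvertible (ψ.tensor χ) (φ.tensor χ)) (hrank : φ.schmidtRank = ψ.schmidtRank) :
    φ.schmidtCoeffs.esymm ψ.schmidtRank ≤ ψ.schmidtCoeffs.esymm ψ.schmidtRank := by
  have hle := h.esymm_schmidtCoeffs_le (ψ.schmidtRank * χ.schmidtRank)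
  have hφ := φ.esymm_schmidtCoeffs_tensor_mul_schmidtRank χ
  rw [hrank] at hφ
  rw [hφ, ψ.esymm_schmidtCoeffs_tensor_mul_schmidtRank] at hle
  exact le_of_pow_le_pow_left₀ χ.schmidtRank_ne_zero (ψ.esymm_schmidtCoeffs_pos le_rfl).le
    (le_of_mul_le_mul_right hle (pow_pos (χ.esymm_schmidtCoeffs_pos le_rfl) _))

theorem LOCCConvertible.concurrence_schmidtRank_le_of_tensor
    (h : LOCCConvertible (ψ.tensor χ) (φ.tensor χ)) (hrank : φ.schmidtRank = ψ.schmidtRank) :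
    φ.concurrence ψ.schmidtRank ψ.schmidtRank ≤ ψ.concurrence ψ.schmidtRank ψ.schmidtRank := by
  have huniform := (esymm_replicate_one_div_pos (le_refl ψ.schmidtRank)).le
  refine Real.rpow_le_rpow (div_nonneg (φ.esymm_schmidtCoeffs_pos hrank.ge).le huniform) ?_
    (by positivity)
  exact div_le_div_of_nonneg_right (h.esymm_schmidtRank_le_of_tensor hrank) huniform

theorem LOCCConvertible.esymm_schmidtRank_pow_mul_le_of_tensor
    (h : LOCCConvertible (ψ.tensor χ) (φ.tensor χ)) (hrank : φ.schmidtRank = ψ.schmidtRank) :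
    φ.schmidtCoeffs.esymm ψ.schmidtRank ^ (χ.schmidtRank - 1)
        * φ.schmidtCoeffs.esymm (ψ.schmidtRank - 1)
      ≤ ψ.schmidtCoeffs.esymm ψ.schmidtRank ^ (χ.schmidtRank - 1)
        * ψ.schmidtCoeffs.esymm (ψ.schmidtRank - 1) := by
  have hle := h.esymm_schmidtCoeffs_le (ψ.schmidtRank * χ.schmidtRank - 1)
  have hφ := φ.esymm_schmidtCoeffs_tensor_mul_schmidtRank_sub_one χ
  rw [hrank] at hφ
  rw [hφ, ψ.esymm_schmidtCoeffs_tensor_mul_schmidtRank_sub_one] at hle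
  exact le_of_mul_le_mul_right hle (mul_pos (pow_pos (χ.esymm_schmidtCoeffs_pos le_rfl) _)
    (χ.esymm_schmidtCoeffs_pos (Nat.sub_le _ _)))

theorem LOCCConvertible.log_esymm_sub_le_of_tensor
    (h : LOCCConvertible (ψ.tensor χ) (φ.tensor χ)) (hrank : φ.schmidtRank = ψ.schmidtRank) :
    Real.log (φ.schmidtCoeffs.esymm (ψ.schmidtRank - 1))
        - Real.log (ψ.schmidtCoeffs.esymm (ψ.schmidtRank - 1))
      ≤ ((χ.schmidtRank - 1 : ℕ) : ℝ) * (Real.log (ψ.schmidtCoeffs.esymm ψ.schmidtRank)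
        - Real.log (φ.schmidtCoeffs.esymm ψ.schmidtRank)) := by
  have hψ := ψ.esymm_schmidtCoeffs_pos le_rfl
  have hφ := φ.esymm_schmidtCoeffs_pos hrank.ge
  have hψ' := ψ.esymm_schmidtCoeffs_pos (Nat.sub_le _ 1)
  have hφ' := φ.esymm_schmidtCoeffs_pos ((Nat.sub_le _ 1).trans hrank.ge)
  have hlog := Real.log_le_log (mul_pos (pow_pos hφ _) hφ')
    (h.esymm_schmidtRank_pow_mul_le_of_tensor hrank)
  rw [Real.log_mul (pow_pos hφ _).ne' hφ'.ne', Real.log_mul (pow_pos hψ _).ne' hψ'.ne',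
    Real.log_pow, Real.log_pow] at hlog
  linarith

end Catalysis

theorem proposition2_general {A B A₂ B₂ A' B' : Type}
    [Fintype A] [DecidableEq A] [Fintype B] [DecidableEq B]
    [Fintype A₂] [DecidableEq A₂] [Fintype B₂] [DecidableEq B₂]
    [Fintype A'] [DecidableEq A'] [Fintype B'] [DecidableEq B']
    (ψ : PureState A B) (φ : PureState A₂ B₂) (χ : PureState A' B') (d b : ℕ)
    (hψ : ψ.schmidtRank = d) (hφ : φ.schmidtRank = d) (hχ : χ.schmidtRank = b)
    (hLOCC : LOCCConvertible (ψ.tensor χ) (φ.tensor χ))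
    (hne : ψ.concurrence d d ≠ φ.concurrence d d) :
    (b : ℝ) ≥ 1 + (((d : ℝ) - 1) / (d : ℝ)) *
      ((Real.log (φ.concurrence d (d - 1)) - Real.log (ψ.concurrence d (d - 1))) /
        (Real.log (ψ.concurrence d d) - Real.log (φ.concurrence d d))) := by
  subst hψ hχ
  set d := ψ.schmidtRank
  set b := χ.schmidtRank
  have hd : 0 < d := Nat.pos_of_ne_zero ψ.schmidtRank_ne_zero
  have htop := ψ.natCast_mul_log_concurrence_sub φ le_rfl le_rfl hφ.ge
  have hsub := φ.natCast_mul_log_concurrence_sub ψ (Nat.sub_le d 1)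
    ((Nat.sub_le d 1).trans hφ.ge) (Nat.sub_le d 1)
  have hlt : φ.concurrence d d < ψ.concurrence d d :=
    (hLOCC.concurrence_schmidtRank_le_of_tensor hφ).lt_of_ne' hne
  have hlog_lt := Real.log_lt_log (φ.concurrence_pos le_rfl hφ.ge) hlt
  have hcatalyst : ((d : ℝ) - 1)
        * (Real.log (φ.concurrence d (d - 1)) - Real.log (ψ.concurrence d (d - 1)))
      ≤ ((b : ℝ) - 1)
        * (d * (Real.log (ψ.concurrence d d) - Real.log (φ.concurrence d d))) := by
    rw [← Nat.cast_pred hd, ← Nat.cast_pred (Nat.pos_of_ne_zero χ.schmidtRank_ne_zero), hsub, htop]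
    exact hLOCC.log_esymm_sub_le_of_tensor hφ
  rw [ge_iff_le, ← le_sub_iff_add_le', div_mul_div_comm,
    div_le_iff₀ (mul_pos (Nat.cast_pos.2 hd) (sub_pos.2 hlog_lt))]
  exact hcatalyst

theorem proposition2 {A B A' B' : Type}
    [Fintype A] [DecidableEq A] [Fintype B] [DecidableEq B]
    [Fintype A'] [DecidableEq A'] [Fintype B'] [DecidableEq B']
    (ψ φ : PureState A B) (χ : PureState A' B') (d b : ℕ)
    (hψ : ψ.schmidtRank = d) (hφ : φ.schmidtRank = d) (hχ : χ.schmidtRank = b)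
    (hLOCC : LOCCConvertible (ψ.tensor χ) (φ.tensor χ))
    (hne : ψ.concurrence d d ≠ φ.concurrence d d) :
    (b : ℝ) ≥ 1 + (((d : ℝ) - 1) / (d : ℝ)) *
      ((Real.log (φ.concurrence d (d - 1)) - Real.log (ψ.concurrence d (d - 1))) /
        (Real.log (ψ.concurrence d d) - Real.log (φ.concurrence d d))) :=
  proposition2_general ψ φ χ d b hψ hφ hχ hLOCC hne
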